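/- **Theorem ($\Delta$–Equivalence Principle).** *Diagrams.* Let $\mathcal H\subset\mathbb Z_{\ge0}\times\mathbb Z_{\ge0}$ be finite, and let $w:\mathcal H\to\mathbb K$ be weights in a field $\mathbb K$. A *gate of type $(r,s)$* is an inner node with $r$ ordered outgoing edges and $s$ ordered ingoing edges. A *labelled diagram of size $n$ on the basis $\mathcal H$* is a directed multigraph, taken up to renaming of its unlabelled vertices and of its edges, with $n$ inner nodes labelled bijectively by $1,\dots,n$, together with *inputs* (vertices of indegree $0$ and outdegree $1$) and *outputs* (vertices of indegree $1$ and outdegree $0$), such that every inner node is a gate whose type lies in $\mathcal H$ (the edges entering it and the edges leaving it being ordered), every edge is incident to at least one inner node, and labels increase along every directed path. Its *weight* is the product of the weights $w_{r,s}$ of its gates. *Embedding.* The diagram is drawn in the plane as follows. Each gate is placed strictly to the north-west of all gates with smaller labels. Its outgoing edges start vertically upwards, ordered from left to right. Its ingoing edges are horizontal and extend from the gate to the right, the first one being the lowest; they lie below the starting points of the outgoing edges of that gate. An edge from one inner node to another consists of a vertical segment followed by a horizontal one; an edge to an output is a vertical half-line prolonged upwards; an edge from an input is a horizontal half-line prolonged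 to the right. The *crossing number* is the number of unordered pairs of edges that cross. Let $C_{n,a,b}\in\mathbb K[t]$ be the sum, over all labelled embedded diagrams of size $n$ on the basis $\mathcal H$ with $a$ outputs and $b$ inputs, of the weight of the diagram times $t^{\text{crossing number}}$. *Statement.* Let $R$ be a commutative $\mathbb K$-algebra and $q\in R$ (for instance $R=\mathbb K[q]$ with $q$ an indeterminate, or $R=\mathbb K=\mathbb R$ and $q\in[0,1]$). Put $c_{n,a,b}(q):=C_{n,a,b}(q)\in R$; for each $n\ge 0$, only finitely many of these are nonzero. 1. In the algebra $R\langle X,\Delta\rangle/(\Delta X-qX\Delta-1)$, let $\mathfrak h=\sum_{(r,s)\in\mathcal H}w_{r,s}X^r\Delta^s$. For every $n\ge0$, the element $\mathfrak h^n$ can be written in exactly one way as a finite $R$-linear combination of the monomials $X^a\Delta^b$, and this normal form is $$\mathfrak N(\mathfrak h^n)=\sum_{a,b\ge0}c_{n,a,b}(q)\,X^a\Delta^b .$$ 2. The same expansion $\mathfrak h^n=\sum_{a,b}c_{n,a,b}(q)X^a\Delta^b$ holds for the operators on $R[[x]]$ given by $(Xf)(x)=xf(x)$ and by the $q$-difference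 operator $\Delta\big(\sum_m f_mx^m\big)=\sum_{m\ge1}f_m[m]_q\,x^{m-1}$, where $[m]_q=1+q+\cdots+q^{m-1}$ (that is, $\Delta f(x)=\frac{f(qx)-f(x)}{(q-1)x}$ when $q-1$ is invertible). If no $[m]_q$ with $m\ge1$ is a zero divisor in $R$, then this is the only expansion of the operator $\mathfrak h^n$ as a finite $R$-linear combination of the operators $X^a\Delta^b$. -/

import Mathlib

noncomputable section

namespace DeltaDiagram

/-! ### Embedded labelled diagrams -/

/-- The outgoing edge-ends of a family of gates: the inner node labelled `j`, of type
`g j = (r, s)`, has `r` outgoing edges, ordered from left to right. -/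
abbrev OutPort {n : ℕ} (g : Fin n → ℕ × ℕ) : Type := Σ j : Fin n, Fin (g j).1

/-- The ingoing edge-ends of a family of gates: the inner node labelled `k`, of type
`g k = (r, s)`, has `s` ingoing edges, ordered from the first to the last. -/
abbrev InPort {n : ℕ} (g : Fin n → ℕ × ℕ) : Type := Σ k : Fin n, Fin (g k).2

/-- A labelled diagram whose inner nodes are labelled by `Fin n` (in increasing order), the node
labelled `j` being a gate of type `g j`. The edge leaving the outgoing end `p` either enters an
inner node through an ingoing end `i` (`link p = some i`) or leads to an output vertex
(`link p = none`). An ingoing end receives at most one edge from an inner node; if it receives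
none, then its edge comes from an input vertex. Labels increase along each edge, hence along each
directed path, and in particular the multigraph is acyclic. Since the inner nodes are labelled
and the edges at each of them are ordered, this is the multigraph up to renaming of its input and
output vertices and of its edges. -/
@[ext] structure Wiring {n : ℕ} (g : Fin n → ℕ × ℕ) where
  link : OutPort g → Option (InPort g)
  link_inj : ∀ p p' i, link p = some i → link p' = some i → p = p'
  link_lt : ∀ p i, link p = some i → p.1 < i.1

namespace Wiring

instance {n : ℕ} (g : Fin n → ℕ × ℕ) : Finite (Wiring g) :=
  Finite.of_injective Wiring.link fun _ _ h => Wiring.ext h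

instance {n : ℕ} (g : Fin n → ℕ × ℕ) : Fintype (Wiring g) := Fintype.ofFinite _

variable {n : ℕ} {g : Fin n → ℕ × ℕ} (δ : Wiring g)

/-- The outgoing ends whose edge leads to an output vertex; they correspond to the outputs. -/
abbrev Output : Type := {p : OutPort g // δ.link p = none}

/-- The ingoing ends whose edge comes from an input vertex; they correspond to the inputs. -/
abbrev Input : Type := {i : InPort g // ∀ p, δ.link p ≠ some i}

/-- The edges: those that leave an inner node, and those that leave an input vertex. -/
abbrev Edge : Type := OutPort g ⊕ δ.Input

end Wiring

/-! The drawing. The gate labelled `j`, of type `(r, s)`, occupies the rectangle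
`[left g j, right g j] × [bottom g j, top g j]`, of width `r` and height `s`. Each gate lies
strictly to the north-west of all gates with smaller labels. Its outgoing edges start from the top
side of the rectangle, from left to right, and its ingoing edges end on the right side, the first
one being the lowest. -/

/-- Abscissa of the left side of the gate labelled `j`. -/
def left {n : ℕ} (g : Fin n → ℕ × ℕ) (j : Fin n) : ℝ :=
  -∑ i ∈ Finset.Iic j, (((g i).1 : ℝ) + 1)

/-- Abscissa of the right side of the gate labelled `j`. -/
def right {n : ℕ} (g : Fin n → ℕ × ℕ) (j : Fin n) : ℝ := left g j + (g j).1

/-- Ordinate of the bottom side of the gate labelled `j`. -/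
def bottom {n : ℕ} (g : Fin n → ℕ × ℕ) (j : Fin n) : ℝ :=
  ∑ i ∈ Finset.Iio j, (((g i).2 : ℝ) + 1)

/-- Ordinate of the top side of the gate labelled `j`. -/
def top {n : ℕ} (g : Fin n → ℕ × ℕ) (j : Fin n) : ℝ := bottom g j + (g j).2

/-- Abscissa of an outgoing end. -/
def column {n : ℕ} (g : Fin n → ℕ × ℕ) (p : OutPort g) : ℝ := left g p.1 + (p.2 : ℕ)

/-- Ordinate of an ingoing end. -/
def row {n : ℕ} (g : Fin n → ℕ × ℕ) (i : InPort g) : ℝ := bottom g i.1 + (i.2 : ℕ)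

namespace Wiring

variable {n : ℕ} {g : Fin n → ℕ × ℕ} (δ : Wiring g)

/-- The set of points of the plane that lie on an edge.
* An edge between two inner nodes leaves the older gate vertically, upwards, and reaches the newer
  one horizontally.
* An edge to an output vertex is a vertical half-line, prolonged upwards.
* An edge from an input vertex is a horizontal half-line, prolonged to the right. -/
def curve : δ.Edge → Set (ℝ × ℝ)
  | .inl p =>
    match δ.link p with
    | some i => {column g p} ×ˢ Set.Icc (top g p.1) (row g i) ∪
        Set.Icc (right g i.1) (column g p) ×ˢ {row g i}
    | none => {column g p} ×ˢ Set.Ici (top g p.1)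
  | .inr i => Set.Ici (right g i.1.1) ×ˢ {row g i.1}

/-- The crossing number: the number of unordered pairs of distinct edges that cross. (As the ends
of the edges are spread along the sides of the gates, two edges have a common point only if they
cross there.) -/
def crossings : ℕ :=
  {s : Sym2 δ.Edge | ∃ e f : δ.Edge, s = s(e, f) ∧ e ≠ f ∧
    (δ.curve e ∩ δ.curve f).Nonempty}.ncard

end Wiring

/-- Labelled embedded diagrams of size `n` on the basis `H`. The drawing is determined by the
labelled diagram. -/
abbrev Diagram (H : Finset (ℕ × ℕ)) (n : ℕ) : Type :=
  Σ g : Fin n → H, Wiring fun j => (g j : ℕ × ℕ)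

namespace Diagram

variable {H : Finset (ℕ × ℕ)} {n : ℕ}

/-- The number of outputs. -/
def numOutputs (δ : Diagram H n) : ℕ := Nat.card δ.2.Output

/-- The number of inputs. -/
def numInputs (δ : Diagram H n) : ℕ := Nat.card δ.2.Input

/-- The weight: the product of the weights of the gates. -/
def weight {K : Type*} [CommMonoid K] (w : H → K) (δ : Diagram H n) : K := ∏ j, w (δ.1 j)

end Diagram

/-- The total weight of the labelled embedded diagrams of size `n` on the basis `H` weighted by
`w`, with `a` outputs and `b` inputs, where the variable of the polynomial marks the number of
crossings. -/
def totalWeight {K : Type*} [CommSemiring K] (H : Finset (ℕ × ℕ)) (w : H → K) (n a b : ℕ) :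
    Polynomial K :=
  ∑ δ : Diagram H n with δ.numOutputs = a ∧ δ.numInputs = b,
    Polynomial.C (δ.weight w) * Polynomial.X ^ δ.2.crossings

/-! ### Normal forms -/

section NormalForm

variable {R A : Type*} [CommRing R] [Ring A] [Algebra R A]

/-- `c` is the family of coefficients of an expression of `u` as a linear combination of the
normally ordered monomials `X ^ a * D ^ b`. -/
def IsNormalForm (X D u : A) (c : ℕ × ℕ →₀ R) : Prop :=
  u = c.sum fun ab r => r • (X ^ ab.1 * D ^ ab.2)

/-- The element `∑ w_{r,s} X ^ r * D ^ s`, the sum being over `(r, s) ∈ H`. -/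
def gatePolynomial (X D : A) (H : Finset (ℕ × ℕ)) (w : H → R) : A :=
  ∑ x : H, w x • (X ^ x.1.1 * D ^ x.1.2)

end NormalForm

section QWeyl

variable {R : Type*} [CommRing R]

/-- The two letters `X` and `Δ`. -/
inductive Letter : Type
  | X
  | Delta

/-- The relation `Δ X = 1 + q X Δ` between noncommutative polynomials. -/
inductive QRel (q : R) : FreeAlgebra R Letter → FreeAlgebra R Letter → Prop
  | rel : QRel q (FreeAlgebra.ι R Letter.Delta * FreeAlgebra.ι R Letter.X)
      (1 + q • (FreeAlgebra.ι R Letter.X * FreeAlgebra.ι R Letter.Delta))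

/-- The algebra of noncommutative polynomials in `X` and `Δ` modulo the two-sided ideal generated
by `Δ X - q X Δ - 1`. -/
abbrev QWeyl (q : R) : Type _ := RingQuot (QRel q)

/-- The class of `X`. -/
def QWeyl.X (q : R) : QWeyl q :=
  RingQuot.mkAlgHom R (QRel q) (FreeAlgebra.ι R Letter.X)

/-- The class of `Δ`. -/
def QWeyl.Delta (q : R) : QWeyl q :=
  RingQuot.mkAlgHom R (QRel q) (FreeAlgebra.ι R Letter.Delta)

end QWeyl

/-! ### The operators on formal power series -/

section Operators

variable {R : Type*} [CommRing R]

/-- The `q`-number `[m] = 1 + q + ⋯ + q ^ (m - 1)`. -/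
def qNumber (q : R) (m : ℕ) : R := ∑ i ∈ Finset.range m, q ^ i

/-- The operator of multiplication by the variable. -/
def mulX (R : Type*) [CommRing R] : Module.End R (PowerSeries R) :=
  LinearMap.mulLeft R PowerSeries.X

/-- The `q`-difference operator `∑ fₘ xᵐ ↦ ∑ fₘ [m] xᵐ⁻¹`. -/
def qDiff (q : R) : Module.End R (PowerSeries R) where
  toFun f := PowerSeries.mk fun m => qNumber q (m + 1) * PowerSeries.coeff (m + 1) f
  map_add' f g := by ext m; simp [mul_add]
  map_smul' r f := by ext m; simp [mul_left_comm]

/-- `(q - 1) x (Δ f)(x) = f (q x) - f x`, which defines `Δ f` when `q - 1` is invertible. -/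
theorem qDiff_spec (q : R) (f : PowerSeries R) :
    (q - 1) • (PowerSeries.X * qDiff q f) = PowerSeries.rescale q f - f := by
  ext m
  cases m with
  | zero =>
    have h : PowerSeries.coeff 0 (PowerSeries.rescale q f) = PowerSeries.coeff 0 f := by
      rw [PowerSeries.coeff_rescale, pow_zero, one_mul]
    rw [map_sub, h, sub_self, PowerSeries.coeff_smul, PowerSeries.coeff_zero_X_mul, smul_zero]
  | succ m =>
    have h := mul_geom_sum q (m + 1)
    simp only [qDiff, qNumber, LinearMap.coe_mk, AddHom.coe_mk, map_smul, smul_eq_mul,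
      PowerSeries.coeff_succ_X_mul, PowerSeries.coeff_mk, map_sub, PowerSeries.coeff_rescale]
    rw [← mul_assoc, h, sub_mul, one_mul]

end Operators

end DeltaDiagram

end

/-!
The normal form of a product of gates is computed by a `q`-analogue of Wick's theorem: if
`Δ X = 1 + q X Δ`, then a word in `X` and `Δ` is the sum, over the partial matchings of its letters
`Δ` with letters `X` to their right, of `q` to the number of crossings times `X ^ a * Δ ^ b`, where
`a` and `b` are the numbers of unmatched letters (`Frame.wickSum_eq_prod`). This is an induction on
the length of the word. A new first letter `X` changes nothing but the exponent `a`. A new first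
letter `Δ` either stays free and crosses the `a` free letters `X`, or is matched with one of these
and crosses those to the left of it; this is the identity
`Δ X ^ a = q ^ a X ^ a Δ + (1 + q + ⋯ + q ^ (a - 1)) X ^ (a - 1)` (`mul_pow_of_mul_eq`).

In the word of a product of gates with the newest gate first, the letters `X` are the outgoing ends
from left to right and the letters `Δ` are the ingoing ends from top to bottom, and a matching of
the word is a wiring of the gates. The vertical part of an edge meets the horizontal part of another
one exactly when the corresponding letters cross in the above sense, and no other parts meet, so
that the crossing number of a diagram is that of the matching (`Wiring.crossings_eq_card`).
Expanding the power of the sum of the gates then gives the expansion in every algebra with two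
elements that satisfy the relation (`isNormalForm_coefficients`).

For the uniqueness in the algebra, let it act on the free module spanned by the symbols of the
monomials `X ^ a * Δ ^ b`: such a monomial maps the symbol of `1` to its own symbol
(`eq_of_isNormalForm`). For the uniqueness of the expansion of an operator, apply a vanishing
combination to `x ^ m` for `m = 0, 1, 2, …`: by induction on `m`, only the terms with `b = m`
contribute, and each coefficient is multiplied by the `q`-factorial of `m`
(`eq_zero_of_isNormalForm_zero`).
-/

noncomputable section

namespace DeltaDiagram

open Finset

/-! ### Powers of `Δ` against powers of `X` -/

section Commutation

variable {R A : Type*} [CommRing R] [Ring A] [Algebra R A]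

theorem mul_pow_of_mul_eq {q : R} {X D : A} (h : D * X = 1 + q • (X * D)) (a : ℕ) :
    D * X ^ a = q ^ a • (X ^ a * D) + (∑ k ∈ range a, q ^ k) • X ^ (a - 1) := by
  induction a with
  | zero => simp
  | succ a ih =>
    have hX : (∑ k ∈ range a, q ^ k) • (X ^ (a - 1) * X) = (∑ k ∈ range a, q ^ k) • X ^ a := by
      cases a with
      | zero => simp
      | succ a => simp [pow_succ]
    rw [pow_succ, ← mul_assoc, ih, add_mul, smul_mul_assoc, smul_mul_assoc, hX, mul_assoc, h,
      mul_add, mul_one, mul_smul_comm, smul_add, smul_smul, sum_range_succ, add_smul,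
      ← mul_assoc, ← pow_succ, ← pow_succ]
    simp only [Nat.add_sub_cancel]
    abel

/-- Each element of a finite set counted with `q` to the power of its rank. -/
theorem sum_pow_rank {P : Type*} {col : P → ℝ} (hcol : Function.Injective col)
    (q : R) (s : Finset P) :
    ∑ p ∈ s, q ^ #{x ∈ s | col x < col p} = ∑ k ∈ range #s, q ^ k := by
  classical
  induction s using Finset.induction_on_max_value col with
  | empty => simp
  | insert a s ha hmax ih =>
    have hlt : ∀ x ∈ s, col x < col a := fun x hx =>
      (hmax x hx).lt_of_ne fun h => ha (hcol h ▸ hx)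
    rw [sum_insert ha, card_insert_of_notMem ha, sum_range_succ, ← ih, add_comm]
    congr 1
    · refine sum_congr rfl fun p hp => ?_
      rw [filter_insert, if_neg (hmax p hp).not_gt]
    · rw [filter_insert, if_neg (lt_irrefl _), filter_true_of_mem hlt]

end Commutation

/-! ### Contractions of words in `X` and `Δ` -/

/-- The relative position of the letters `X`, indexed by `P`, and the letters `Δ`, indexed by `I`,
of a word: the letters `X` are ordered by `col`, increasing from left to right, the letters `Δ` are
ordered by `row`, decreasing from left to right, and `meets p i` says that the letter `Δ` indexed by
`i` is to the left of the letter `X` indexed by `p`. -/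
structure Frame (P I : Type*) where
  col : P → ℝ
  row : I → ℝ
  meets : P → I → Prop

namespace Frame

variable {P I : Type*} [Fintype P] [Fintype I] (F : Frame P I) (S : Finset P) (T : Finset I)

open scoped Classical in
/-- The contractions of the letters in `S` and `T`: partial matchings of the letters `X` in `S` with
letters `Δ` in `T` that are to their left. -/
def contractions : Finset (P → Option I) :=
  {f | (∀ p p' i, f p = some i → f p' = some i → p = p') ∧
    ∀ p i, f p = some i → p ∈ S ∧ i ∈ T ∧ F.meets p i}

/-- The letters `X` that a contraction leaves free. -/
def freeOut (f : P → Option I) : Finset P := {p ∈ S | f p = none}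

open scoped Classical in
/-- The letters `Δ` that a contraction leaves free. -/
def freeIn (f : P → Option I) : Finset I := {i ∈ T | ∀ p, f p ≠ some i}

open scoped Classical in
/-- The crossings of a contraction: a letter `Δ` and a letter `X` to its right, such that the
partner of the former, if any, is to the right of the latter and the partner of the latter, if any,
is to the left of the former. -/
def crossingPairs (f : P → Option I) : Finset (P × I) :=
  {x ∈ S ×ˢ T | F.meets x.1 x.2 ∧ (∀ i, f x.1 = some i → F.row x.2 < F.row i) ∧
    ∀ p, f p = some x.2 → F.col x.1 < F.col p}

variable {F S T} {f : P → Option I}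

theorem mem_contractions : f ∈ F.contractions S T ↔
    (∀ p p' i, f p = some i → f p' = some i → p = p') ∧
      ∀ p i, f p = some i → p ∈ S ∧ i ∈ T ∧ F.meets p i := by
  simp [contractions]

omit [Fintype P] [Fintype I] in
theorem mem_freeOut {p : P} : p ∈ freeOut S f ↔ p ∈ S ∧ f p = none := by
  simp [freeOut]

omit [Fintype I] in
theorem mem_freeIn {i : I} : i ∈ freeIn T f ↔ i ∈ T ∧ ∀ p, f p ≠ some i := by
  simp [freeIn]

theorem mem_crossingPairs {p : P} {i : I} : (p, i) ∈ F.crossingPairs S T f ↔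
    (p ∈ S ∧ i ∈ T) ∧ F.meets p i ∧ (∀ i', f p = some i' → F.row i < F.row i') ∧
      ∀ p', f p' = some i → F.col p < F.col p' := by
  simp [crossingPairs]

section NewDelta

variable {i : I} (hi : i ∉ T) (hmeets : ∀ p ∈ S, F.meets p i) (hrow : ∀ j ∈ T, F.row j < F.row i)

open scoped Classical in
include hi hmeets in
/-- A contraction of a word `Δ u` is a contraction of `u`, together with the choice of a partner of
the first letter `Δ`, if any, among the free letters `X`. -/
theorem sum_contractions_insert {M : Type*} [AddCommMonoid M] (φ : (P → Option I) → M) :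
    ∑ f ∈ F.contractions S (insert i T), φ f =
      ∑ f ∈ F.contractions S T,
        (φ f + ∑ p ∈ freeOut S f, φ (Function.update f p (some i))) := by
  rw [sum_add_distrib, ← sum_filter_not_add_sum_filter _ (fun f => ∃ p, f p = some i)]
  congr 1
  -- The contractions that leave `i` free are those of `S` and `T`.
  · refine sum_congr ?_ fun _ _ => rfl
    ext f
    simp only [mem_filter, mem_contractions, mem_insert, not_exists]
    constructor
    · rintro ⟨⟨h1, h2⟩, h3⟩
      refine ⟨h1, fun p j hj => ⟨(h2 p j hj).1, ?_, (h2 p j hj).2.2⟩⟩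
      rcases (h2 p j hj).2.1 with rfl | h
      · exact absurd hj (h3 p)
      · exact h
    · rintro ⟨h1, h2⟩
      refine ⟨⟨h1, fun p j hj => ⟨(h2 p j hj).1, Or.inr (h2 p j hj).2.1, (h2 p j hj).2.2⟩⟩, ?_⟩
      exact fun p hp => hi (h2 p i hp).2.1
  -- A contraction that matches `p` with `i` comes from the one where `p` is left free.
  · rw [sum_sigma']
    symm
    refine sum_bij (fun x _ => Function.update x.1 x.2 (some i)) ?_ ?_ ?_ fun _ _ => rfl
    · rintro ⟨f, p⟩ hx
      simp only [mem_sigma, mem_contractions, mem_freeOut] at hx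
      obtain ⟨⟨h1, h2⟩, hp, hfp⟩ := hx
      have hne : ∀ p', f p' ≠ some i := fun p' h => hi (h2 p' i h).2.1
      simp only [mem_filter, mem_contractions, mem_insert]
      refine ⟨⟨fun a b j ha hb => ?_, fun a j ha => ?_⟩, p, by simp⟩
      · by_cases hap : a = p <;> by_cases hbp : b = p
        · rw [hap, hbp]
        · subst hap
          simp only [Function.update_self, Function.update_of_ne hbp, Option.some.injEq] at ha hb
          exact absurd (ha ▸ hb) (hne b)
        · subst hbp
          simp only [Function.update_self, Function.update_of_ne hap, Option.some.injEq] at ha hb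
          exact absurd (hb ▸ ha) (hne a)
        · rw [Function.update_of_ne hap] at ha
          rw [Function.update_of_ne hbp] at hb
          exact h1 a b j ha hb
      · by_cases hap : a = p
        · subst hap
          simp only [Function.update_self, Option.some.injEq] at ha
          subst ha
          exact ⟨hp, Or.inl rfl, hmeets a hp⟩
        · rw [Function.update_of_ne hap] at ha
          exact ⟨(h2 a j ha).1, Or.inr (h2 a j ha).2.1, (h2 a j ha).2.2⟩
    · rintro ⟨f, p⟩ hx ⟨f', p'⟩ hx' h
      simp only [mem_sigma, mem_contractions, mem_freeOut] at hx hx'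
      obtain ⟨⟨-, h2⟩, hp, hfp⟩ := hx
      obtain ⟨⟨-, h2'⟩, hp', hfp'⟩ := hx'
      dsimp only at h h2 h2' hfp hfp'
      have hpp : p = p' := by
        by_contra hne
        have := congrFun h p
        rw [Function.update_self, Function.update_of_ne hne] at this
        exact hi (h2' p i this.symm).2.1
      subst hpp
      have hff : f = f' := by
        funext a
        by_cases hap : a = p
        · rw [hap, hfp, hfp']
        · have := congrFun h a
          rwa [Function.update_of_ne hap, Function.update_of_ne hap] at this
      rw [hff]
    · intro f hf
      simp only [mem_filter, mem_contractions, mem_insert] at hf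
      obtain ⟨⟨h1, h2⟩, p, hp⟩ := hf
      have key : ∀ a j, Function.update f p none a = some j → a ≠ p ∧ f a = some j := by
        intro a j ha
        by_cases hap : a = p
        · simp [hap] at ha
        · exact ⟨hap, by rwa [Function.update_of_ne hap] at ha⟩
      refine ⟨⟨Function.update f p none, p⟩, ?_, ?_⟩
      · simp only [mem_sigma, mem_contractions, mem_freeOut, Function.update_self, and_true]
        refine ⟨⟨fun a b j ha hb => h1 a b j (key a j ha).2 (key b j hb).2, fun a j ha => ?_⟩,
          (h2 p i hp).1⟩
        obtain ⟨hap, ha⟩ := key a j ha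
        obtain ⟨h3, h4, h5⟩ := h2 a j ha
        refine ⟨h3, h4.resolve_left ?_, h5⟩
        rintro rfl
        exact hap (h1 a p j ha hp)
      · simp [← hp]

variable (hf : f ∈ F.contractions S T)

include hf in
theorem ne_some_of_notMem {i : I} (hi : i ∉ T) (p : P) : f p ≠ some i :=
  fun h => hi ((mem_contractions.1 hf).2 p i h).2.1

open scoped Classical in
include hi hmeets hrow hf in
/-- A new first letter `Δ` that is left free crosses the free letters `X`. -/
theorem card_crossingPairs_insert :
    #(F.crossingPairs S (insert i T) f) = #(F.crossingPairs S T f) + #(freeOut S f) := by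
  have hne := ne_some_of_notMem hf hi
  have hun : F.crossingPairs S (insert i T) f =
      F.crossingPairs S T f ∪ (freeOut S f).image fun p => (p, i) := by
    ext ⟨p, j⟩
    simp only [mem_union, mem_image, Prod.mk.injEq, mem_crossingPairs, mem_insert, mem_freeOut]
    constructor
    · rintro ⟨⟨hp, rfl | hj⟩, h1, h2, h3⟩
      · refine Or.inr ⟨p, ⟨hp, ?_⟩, rfl, rfl⟩
        rw [Option.eq_none_iff_forall_ne_some]
        intro j' hj'
        exact (h2 j' hj').not_gt (hrow j' ((mem_contractions.1 hf).2 p j' hj').2.1)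
      · exact Or.inl ⟨⟨hp, hj⟩, h1, h2, h3⟩
    · rintro (⟨⟨hp, hj⟩, h⟩ | ⟨p, ⟨hp, hfp⟩, rfl, rfl⟩)
      · exact ⟨⟨hp, Or.inr hj⟩, h⟩
      · exact ⟨⟨hp, Or.inl rfl⟩, hmeets p hp, by simp [hfp], fun p' h => absurd h (hne p')⟩
  rw [hun, card_union_of_disjoint, card_image_of_injective _ fun _ _ h => (Prod.mk.inj h).1]
  rw [disjoint_left]
  rintro ⟨p, j⟩ h1 h2
  simp only [mem_image, Prod.mk.injEq, mem_crossingPairs] at h1 h2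
  obtain ⟨_, _, _, rfl⟩ := h2
  exact hi h1.1.2

open scoped Classical in
include hi hmeets hrow hf in
/-- A new first letter `Δ` that is contracted with a letter `X` crosses the free letters `X` to the
left of the latter. -/
theorem card_crossingPairs_update {p : P} (hp : p ∈ freeOut S f) :
    #(F.crossingPairs S (insert i T) (Function.update f p (some i))) =
      #(F.crossingPairs S T f) + #{x ∈ freeOut S f | F.col x < F.col p} := by
  have hne := ne_some_of_notMem hf hi
  obtain ⟨hpS, hfp⟩ := mem_freeOut.1 hp
  have hun : F.crossingPairs S (insert i T) (Function.update f p (some i)) =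
      F.crossingPairs S T f ∪
        ({x ∈ freeOut S f | F.col x < F.col p} : Finset P).image fun p => (p, i) := by
    ext ⟨a, j⟩
    simp only [mem_union, mem_image, Prod.mk.injEq, mem_crossingPairs, mem_insert, mem_freeOut,
      mem_filter]
    have hupd : ∀ {j b}, j ≠ i → (Function.update f p (some i) b = some j ↔ f b = some j) := by
      intro j b hj
      by_cases hb : b = p
      · subst hb
        simp [hfp, hj.symm]
      · rw [Function.update_of_ne hb]
    constructor
    · rintro ⟨⟨ha, hj⟩, h1, h2, h3⟩
      by_cases hji : j = i
      · subst hji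
        have hlt := h3 p (by simp)
        have hap : a ≠ p := by
          rintro rfl
          exact lt_irrefl _ hlt
        refine Or.inr ⟨a, ⟨⟨ha, ?_⟩, hlt⟩, rfl, rfl⟩
        rw [Option.eq_none_iff_forall_ne_some]
        intro j' hj'
        refine (h2 j' ?_).not_gt (hrow j' ((mem_contractions.1 hf).2 a j' hj').2.1)
        rwa [Function.update_of_ne hap]
      · have hjT := hj.resolve_left hji
        refine Or.inl ⟨⟨ha, hjT⟩, h1, fun j' hj' => ?_, fun p' hp' => h3 p' ((hupd hji).2 hp')⟩
        refine h2 j' ((hupd ?_).2 hj')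
        rintro rfl
        exact hne a hj'
    · rintro (⟨⟨ha, hj⟩, h1, h2, h3⟩ | ⟨a, ⟨⟨ha, hfa⟩, hlt⟩, rfl, rfl⟩)
      · have hji : j ≠ i := fun h => hi (h ▸ hj)
        refine ⟨⟨ha, Or.inr hj⟩, h1, fun j' hj' => ?_, fun p' hp' => h3 p' ((hupd hji).1 hp')⟩
        by_cases hj'i : j' = i
        · exact hj'i ▸ hrow j hj
        · exact h2 j' ((hupd hj'i).1 hj')
      · have hap : a ≠ p := by
          rintro rfl
          exact lt_irrefl _ hlt
        refine ⟨⟨ha, Or.inl rfl⟩, hmeets a ha, fun j' hj' => ?_, fun p' hp' => ?_⟩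
        · simp [Function.update_of_ne hap, hfa] at hj'
        · by_cases hpp : p' = p
          · exact hpp ▸ hlt
          · rw [Function.update_of_ne hpp] at hp'
            exact absurd hp' (hne p')
  rw [hun, card_union_of_disjoint, card_image_of_injective _ fun _ _ h => (Prod.mk.inj h).1]
  rw [disjoint_left]
  rintro ⟨a, j⟩ h1 h2
  simp only [mem_image, Prod.mk.injEq, mem_crossingPairs] at h1 h2
  obtain ⟨_, _, _, rfl⟩ := h2
  exact hi h1.1.2

open scoped Classical in
include hi hf in
theorem card_freeIn_insert : #(freeIn (insert i T) f) = #(freeIn T f) + 1 := by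
  rw [freeIn, filter_insert, if_pos (ne_some_of_notMem hf hi), card_insert_of_notMem, freeIn]
  simp [hi]

open scoped Classical in
omit [Fintype I] in
include hi in
theorem freeIn_insert_update {p : P} (hfp : f p = none) :
    freeIn (insert i T) (Function.update f p (some i)) = freeIn T f := by
  ext j
  simp only [mem_freeIn, mem_insert]
  constructor
  · rintro ⟨hj, h⟩
    have hji : j ≠ i := by
      rintro rfl
      exact h p (by simp)
    refine ⟨hj.resolve_left hji, fun a ha => h a ?_⟩
    rwa [Function.update_of_ne]
    rintro rfl
    simp [hfp] at ha
  · rintro ⟨hj, h⟩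
    refine ⟨Or.inr hj, fun a ha => ?_⟩
    by_cases hap : a = p
    · subst hap
      simp only [Function.update_self, Option.some.injEq] at ha
      exact hi (ha ▸ hj)
    · rw [Function.update_of_ne hap] at ha
      exact h a ha

open scoped Classical in
omit [Fintype P] [Fintype I] in
theorem freeOut_update (p : P) :
    freeOut S (Function.update f p (some i)) = (freeOut S f).erase p := by
  ext a
  simp only [mem_freeOut, mem_erase]
  by_cases hap : a = p
  · subst hap
    simp
  · simp [hap]

end NewDelta

section Wick

variable {R A : Type*} [CommRing R] [Ring A] [Algebra R A] (q : R) (X D : A) (F S T)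

/-- The normally ordered monomial of a contraction, with `q` marking the crossings. -/
def wickTerm (f : P → Option I) : A :=
  q ^ #(F.crossingPairs S T f) • (X ^ #(freeOut S f) * D ^ #(freeIn T f))

/-- The sum over the contractions of the normally ordered monomials they leave. -/
def wickSum : A := ∑ f ∈ F.contractions S T, F.wickTerm S T q X D f

variable {q X D F S T}

theorem wickSum_empty : F.wickSum ∅ ∅ q X D = 1 := by
  have : F.contractions ∅ ∅ = {fun _ => none} := by
    ext f
    simp only [mem_contractions, mem_singleton, notMem_empty, false_and]
    constructor
    · rintro ⟨-, h⟩
      funext p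
      rw [Option.eq_none_iff_forall_ne_some]
      exact fun i => h p i
    · rintro rfl
      simp
  simp [wickSum, wickTerm, this, crossingPairs, freeOut, freeIn]

open scoped Classical in
theorem wickSum_insert_out {p : P} (hp : p ∉ S) (hmeets : ∀ i ∈ T, ¬ F.meets p i) :
    F.wickSum (insert p S) T q X D = X * F.wickSum S T q X D := by
  have hc : F.contractions (insert p S) T = F.contractions S T := by
    ext f
    simp only [mem_contractions, mem_insert]
    refine and_congr_right fun _ => forall₃_congr fun a i _ =>
      ⟨?_, fun h => ⟨Or.inr h.1, h.2⟩⟩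
    rintro ⟨rfl | h, h'⟩
    · exact absurd h'.2 (hmeets i h'.1)
    · exact ⟨h, h'⟩
  rw [wickSum, wickSum, hc, mul_sum]
  refine sum_congr rfl fun f hf => ?_
  have hfp : f p = none := by
    rw [Option.eq_none_iff_forall_ne_some]
    exact fun i h => hp ((mem_contractions.1 hf).2 p i h).1
  have hcr : F.crossingPairs (insert p S) T f = F.crossingPairs S T f := by
    ext ⟨a, i⟩
    simp only [mem_crossingPairs, mem_insert]
    constructor
    · rintro ⟨⟨rfl | ha, hi⟩, h⟩
      · exact absurd h.1 (hmeets i hi)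
      · exact ⟨⟨ha, hi⟩, h⟩
    · rintro ⟨⟨ha, hi⟩, h⟩
      exact ⟨⟨Or.inr ha, hi⟩, h⟩
  have hfo : #(freeOut (insert p S) f) = #(freeOut S f) + 1 := by
    rw [freeOut, filter_insert, if_pos hfp, card_insert_of_notMem, freeOut]
    simp [hp]
  rw [wickTerm, wickTerm, hcr, hfo, pow_succ', mul_smul_comm, mul_assoc]

open scoped Classical in
theorem wickSum_insert_in (hX : D * X = 1 + q • (X * D)) (hcol : Function.Injective F.col) {i : I}
    (hi : i ∉ T) (hmeets : ∀ p ∈ S, F.meets p i) (hrow : ∀ j ∈ T, F.row j < F.row i) :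
    F.wickSum S (insert i T) q X D = D * F.wickSum S T q X D := by
  rw [wickSum, sum_contractions_insert hi hmeets, wickSum, mul_sum]
  refine sum_congr rfl fun f hf => ?_
  have hupd : ∀ p ∈ freeOut S f, F.wickTerm S (insert i T) q X D (Function.update f p (some i)) =
      q ^ #{x ∈ freeOut S f | F.col x < F.col p} •
        (q ^ #(F.crossingPairs S T f) • (X ^ (#(freeOut S f) - 1) * D ^ #(freeIn T f))) := by
    intro p hp
    rw [wickTerm, card_crossingPairs_update hi hmeets hrow hf hp,
      freeIn_insert_update hi (mem_freeOut.1 hp).2, freeOut_update, card_erase_of_mem hp,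
      smul_smul, ← pow_add, add_comm]
  rw [sum_congr rfl hupd, ← sum_smul, sum_pow_rank hcol, wickTerm,
    card_crossingPairs_insert hi hmeets hrow hf, card_freeIn_insert hi hf, wickTerm,
    mul_smul_comm, ← mul_assoc, mul_pow_of_mul_eq hX, add_mul, smul_mul_assoc, smul_mul_assoc,
    mul_assoc, ← pow_succ', pow_add]
  simp only [smul_add, smul_smul, mul_comm]

variable (F) in
/-- `F.Before x y` says that the letter indexed by `x` is to the left of the one indexed by `y`. -/
def Before : P ⊕ I → P ⊕ I → Prop
  | .inl p, .inl p' => F.col p < F.col p'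
  | .inr i, .inr i' => F.row i' < F.row i
  | .inr i, .inl p => F.meets p i
  | .inl p, .inr i => ¬ F.meets p i

open scoped Classical in
/-- The `q`-Wick theorem: a word in `X` and `Δ` is the sum over its contractions of the normally
ordered monomials they leave, with `q` marking the crossings. -/
theorem wickSum_eq_prod (hX : D * X = 1 + q • (X * D)) (hcol : Function.Injective F.col)
    (l : List (P ⊕ I)) (hl : l.Pairwise F.Before) :
    F.wickSum {p | .inl p ∈ l} {i | .inr i ∈ l} q X D =
      (l.map (Sum.elim (fun _ => X) fun _ => D)).prod := by
  induction l with
  | nil => simp [wickSum_empty]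
  | cons x l ih =>
    rw [List.pairwise_cons] at hl
    rw [List.map_cons, List.prod_cons, ← ih hl.2]
    cases x with
    | inl p =>
      have hS : ({p' | .inl p' ∈ .inl p :: l} : Finset P) =
          insert p ({p' | .inl p' ∈ l} : Finset P) := by
        ext; simp
      have hT : ({i | .inr i ∈ .inl p :: l} : Finset I) = ({i | .inr i ∈ l} : Finset I) := by
        ext; simp
      rw [hS, hT]
      refine wickSum_insert_out (fun h => ?_) fun i h => ?_
      · exact lt_irrefl (F.col p) (hl.1 (.inl p) (mem_filter.1 h).2)
      · exact hl.1 (.inr i) (mem_filter.1 h).2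
    | inr i =>
      have hS : ({p' | .inl p' ∈ .inr i :: l} : Finset P) = ({p' | .inl p' ∈ l} : Finset P) := by
        ext; simp
      have hT : ({j | .inr j ∈ .inr i :: l} : Finset I) =
          insert i ({j | .inr j ∈ l} : Finset I) := by
        ext; simp
      rw [hS, hT]
      refine wickSum_insert_in hX hcol (fun h => ?_) (fun p h => ?_) fun j h => ?_
      · exact lt_irrefl (F.row i) (hl.1 (.inr i) (mem_filter.1 h).2)
      · exact hl.1 (.inl p) (mem_filter.1 h).2
      · exact hl.1 (.inr j) (mem_filter.1 h).2

end Wick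

end Frame

/-! ### The drawing of a diagram -/

section Drawing

variable {n : ℕ} (g : Fin n → ℕ × ℕ)

theorem right_eq (k : Fin n) : right g k = -∑ i ∈ Iio k, (((g i).1 : ℝ) + 1) - 1 := by
  rw [right, left, ← Iio_insert, sum_insert (by simp)]
  ring

theorem right_lt_left {j k : Fin n} (h : j < k) : right g k < left g j := by
  have : ∑ i ∈ Iic j, (((g i).1 : ℝ) + 1) ≤ ∑ i ∈ Iio k, (((g i).1 : ℝ) + 1) :=
    sum_le_sum_of_subset_of_nonneg
      (fun i hi => mem_Iio.2 ((mem_Iic.1 hi).trans_lt h)) fun i _ _ => by positivity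
  rw [right_eq, left]
  linarith

theorem top_eq (j : Fin n) : top g j = ∑ i ∈ Iic j, (((g i).2 : ℝ) + 1) - 1 := by
  rw [top, bottom, ← Iio_insert, sum_insert (by simp)]
  ring

theorem top_lt_bottom {j k : Fin n} (h : j < k) : top g j < bottom g k := by
  have : ∑ i ∈ Iic j, (((g i).2 : ℝ) + 1) ≤ ∑ i ∈ Iio k, (((g i).2 : ℝ) + 1) :=
    sum_le_sum_of_subset_of_nonneg
      (fun i hi => mem_Iio.2 ((mem_Iic.1 hi).trans_lt h)) fun i _ _ => by positivity
  rw [top_eq, bottom]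
  linarith

theorem left_le_column (p : OutPort g) : left g p.1 ≤ column g p := by
  simp [column]

theorem column_lt_right (p : OutPort g) : column g p < right g p.1 := by
  simp [column, right]

theorem bottom_le_row (i : InPort g) : bottom g i.1 ≤ row g i := by
  simp [row]

theorem row_lt_top (i : InPort g) : row g i < top g i.1 := by
  simp [row, top]

variable {g}

theorem column_lt_column {p p' : OutPort g} (h : p'.1 < p.1) : column g p < column g p' :=
  (column_lt_right g p).trans ((right_lt_left g h).trans_le (left_le_column g p'))

theorem row_lt_row {i i' : InPort g} (h : i.1 < i'.1) : row g i < row g i' :=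
  (row_lt_top g i).trans ((top_lt_bottom g h).trans_le (bottom_le_row g i'))

variable (g)

theorem column_injective : Function.Injective (column g) := by
  rintro ⟨j, t⟩ ⟨j', t'⟩ h
  rcases lt_trichotomy j j' with hj | rfl | hj
  · exact absurd h (column_lt_column (p := ⟨j', t'⟩) (p' := ⟨j, t⟩) hj).ne'
  · have : (t : ℕ) = t' := by simpa [column] using h
    rw [Fin.ext this]
  · exact absurd h (column_lt_column (p := ⟨j, t⟩) (p' := ⟨j', t'⟩) hj).ne

theorem row_injective : Function.Injective (row g) := by
  rintro ⟨j, t⟩ ⟨j', t'⟩ h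
  rcases lt_trichotomy j j' with hj | rfl | hj
  · exact absurd h (row_lt_row (i := ⟨j, t⟩) (i' := ⟨j', t'⟩) hj).ne
  · have : (t : ℕ) = t' := by simpa [row] using h
    rw [Fin.ext this]
  · exact absurd h (row_lt_row (i := ⟨j', t'⟩) (i' := ⟨j, t⟩) hj).ne'

variable {g}

theorem right_le_column_iff {p : OutPort g} {i : InPort g} :
    right g i.1 ≤ column g p ↔ p.1 < i.1 := by
  refine ⟨fun h => ?_, fun h => (right_lt_left g h).le.trans (left_le_column g p)⟩
  by_contra! hle
  refine h.not_gt ((column_lt_right g p).trans_le ?_)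
  rcases hle.eq_or_lt with h | h
  · rw [h]
  · exact (right_lt_left g h).le.trans (by simp [right])

theorem top_le_row {p : OutPort g} {i : InPort g} (h : p.1 < i.1) : top g p.1 ≤ row g i :=
  (top_lt_bottom g h).le.trans (bottom_le_row g i)

end Drawing

/-- The ports of a family of gates, in the word obtained by reading the gates from the newest to the
oldest, each gate contributing a letter `X` for each outgoing end, from left to right, and then a
letter `Δ` for each ingoing end, from the last to the first. -/
def portFrame {n : ℕ} (g : Fin n → ℕ × ℕ) : Frame (OutPort g) (InPort g) where
  col := column g
  row := row g
  meets p i := p.1 < i.1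

namespace Wiring

variable {n : ℕ} {g : Fin n → ℕ × ℕ} (δ : Wiring g)

open scoped Classical in
/-- The edge that enters an inner node through a given ingoing end. -/
def edgeTo (i : InPort g) : δ.Edge :=
  if h : ∃ p, δ.link p = some i then .inl h.choose else .inr ⟨i, fun p hp => h ⟨p, hp⟩⟩

variable {δ}

theorem edgeTo_eq_inl_iff {i : InPort g} {p : OutPort g} :
    δ.edgeTo i = .inl p ↔ δ.link p = some i := by
  unfold edgeTo
  split_ifs with h
  · rw [Sum.inl.injEq]
    refine ⟨fun hp => hp ▸ h.choose_spec, fun hp => δ.link_inj _ _ i h.choose_spec hp⟩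
  · simp only [false_iff]
    exact fun hp => h ⟨p, hp⟩

theorem edgeTo_coe_input (i : δ.Input) : δ.edgeTo i.1 = .inr i := by
  rw [edgeTo, dif_neg]
  rintro ⟨p, hp⟩
  exact i.2 p hp

theorem edgeTo_injective : Function.Injective δ.edgeTo := by
  intro i j h
  rcases hi : δ.edgeTo i with p | a
  · have h1 := edgeTo_eq_inl_iff.1 hi
    have h2 := edgeTo_eq_inl_iff.1 (h ▸ hi)
    exact Option.some_injective _ (h1.symm.trans h2)
  · have key : ∀ k, δ.edgeTo k = .inr a → k = a.1 := by
      intro k hk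
      unfold edgeTo at hk
      split_ifs at hk
      exact congrArg Subtype.val (Sum.inr.inj hk)
    rw [key i hi, key j (h ▸ hi)]

variable (δ)

/-- The vertical part of the edge that leaves an inner node through a given outgoing end. -/
def verticalPart (p : OutPort g) : Set (ℝ × ℝ) :=
  {z | z.1 = column g p ∧ top g p.1 ≤ z.2 ∧ ∀ i, δ.link p = some i → z.2 ≤ row g i}

/-- The horizontal part of the edge that enters an inner node through a given ingoing end. -/
def horizontalPart (i : InPort g) : Set (ℝ × ℝ) :=
  {z | z.2 = row g i ∧ right g i.1 ≤ z.1 ∧ ∀ p, δ.link p = some i → z.1 ≤ column g p}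

variable {δ}

theorem mem_curve_iff {e : δ.Edge} {z : ℝ × ℝ} :
    z ∈ δ.curve e ↔ (∃ p, e = .inl p ∧ z ∈ δ.verticalPart p) ∨
      ∃ i, e = δ.edgeTo i ∧ z ∈ δ.horizontalPart i := by
  obtain ⟨x, y⟩ := z
  rcases e with p | i
  · rcases hp : δ.link p with _ | i
    · have : ∀ i, ¬ (Sum.inl p : δ.Edge) = δ.edgeTo i := fun i h => by
        simp [edgeTo_eq_inl_iff.1 h.symm] at hp
      simp [curve, hp, verticalPart, this]
    · have h1 : ∀ j, (Sum.inl p : δ.Edge) = δ.edgeTo j ↔ j = i := fun j => by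
        rw [eq_comm, edgeTo_eq_inl_iff, hp, Option.some.injEq, eq_comm]
      have h2 : ∀ p', δ.link p' = some i ↔ p' = p := fun p' =>
        ⟨fun h => δ.link_inj _ _ i h hp, fun h => h ▸ hp⟩
      simp only [curve, hp, verticalPart, horizontalPart, h1, h2, Sum.inl.injEq, Set.mem_union,
        Set.mem_prod, Set.mem_singleton_iff, Set.mem_Icc, Set.mem_ofPred_eq, exists_eq_left,
        exists_eq_left', forall_eq, Option.some.injEq, forall_eq']
      tauto
  · have h1 : ∀ j, (Sum.inr i : δ.Edge) = δ.edgeTo j ↔ j = i.1 := fun j => by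
      rw [← edgeTo_coe_input i]
      exact ⟨fun h => (edgeTo_injective h).symm, fun h => h ▸ rfl⟩
    have h2 : ∀ p, ¬ δ.link p = some i.1 := i.2
    simp only [curve, horizontalPart, h1, h2, Set.mem_prod, Set.mem_singleton_iff, Set.mem_Ici,
      Set.mem_ofPred_eq, exists_eq_left, reduceCtorEq, false_and, exists_false, false_or,
      false_imp_iff, implies_true, and_true]
    tauto

theorem verticalPart_inter_horizontalPart_nonempty {p : OutPort g} {i : InPort g}
    (hne : δ.edgeTo i ≠ .inl p) :
    (δ.verticalPart p ∩ δ.horizontalPart i).Nonempty ↔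
      (p, i) ∈ (portFrame g).crossingPairs univ univ δ.link := by
  rw [Ne, edgeTo_eq_inl_iff] at hne
  simp only [Frame.mem_crossingPairs, mem_univ, true_and, portFrame]
  constructor
  · rintro ⟨⟨x, y⟩, ⟨hx, -, hy⟩, hy', hx', hx''⟩
    dsimp only at hx hy hy' hx' hx''
    subst hx hy'
    refine ⟨right_le_column_iff.1 hx', fun j hj => (hy j hj).lt_of_ne fun h => ?_,
      fun p' hp' => (hx'' p' hp').lt_of_ne fun h => ?_⟩
    · exact hne (row_injective g h ▸ hj)
    · exact hne (column_injective g h ▸ hp')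
  · rintro ⟨h1, h2, h3⟩
    exact ⟨(column g p, row g i), ⟨rfl, top_le_row h1, fun j hj => (h2 j hj).le⟩, rfl,
      right_le_column_iff.2 h1, fun p' hp' => (h3 p' hp').le⟩

theorem edgeTo_ne_of_mem_crossingPairs {p : OutPort g} {i : InPort g}
    (h : (p, i) ∈ (portFrame g).crossingPairs univ univ δ.link) : δ.edgeTo i ≠ .inl p := by
  rw [Ne, edgeTo_eq_inl_iff]
  exact fun hp => lt_irrefl _ ((Frame.mem_crossingPairs.1 h).2.2.1 i hp)

variable (δ)

/-- Two vertical parts, or two horizontal parts, never meet, and two edges cross at most once, so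
that the crossings are the pairs of a vertical and a horizontal part that meet. -/
theorem crossings_eq_card :
    δ.crossings = #((portFrame g).crossingPairs univ univ δ.link) := by
  have himg : {s : Sym2 δ.Edge | ∃ e f : δ.Edge, s = s(e, f) ∧ e ≠ f ∧
      (δ.curve e ∩ δ.curve f).Nonempty} =
      (fun x : OutPort g × InPort g => s(.inl x.1, δ.edgeTo x.2)) ''
        ((portFrame g).crossingPairs univ univ δ.link : Set (OutPort g × InPort g)) := by
    ext s
    constructor
    · rintro ⟨e, f, rfl, hef, z, he, hf⟩
      rcases mem_curve_iff.1 he with ⟨p, rfl, hp⟩ | ⟨i, rfl, hi⟩ <;>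
        rcases mem_curve_iff.1 hf with ⟨p', rfl, hp'⟩ | ⟨i', rfl, hi'⟩
      · exact absurd (congrArg Sum.inl (column_injective g (hp.1.symm.trans hp'.1))) hef
      · exact ⟨(p, i'),
          (verticalPart_inter_horizontalPart_nonempty hef.symm).1 ⟨z, hp, hi'⟩, rfl⟩
      · exact ⟨(p', i),
          (verticalPart_inter_horizontalPart_nonempty hef).1 ⟨z, hp', hi⟩, Sym2.eq_swap⟩
      · exact absurd (congrArg δ.edgeTo (row_injective g (hi.1.symm.trans hi'.1))) hef
    · rintro ⟨⟨p, i⟩, hpi, rfl⟩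
      have hne := edgeTo_ne_of_mem_crossingPairs hpi
      obtain ⟨z, hz, hz'⟩ := (verticalPart_inter_horizontalPart_nonempty hne).2 hpi
      exact ⟨.inl p, δ.edgeTo i, rfl, hne.symm, z, mem_curve_iff.2 (.inl ⟨p, rfl, hz⟩),
        mem_curve_iff.2 (.inr ⟨i, rfl, hz'⟩)⟩
  rw [crossings, himg, Set.InjOn.ncard_image, Set.ncard_coe_finset]
  rintro ⟨p, i⟩ hpi ⟨p', i'⟩ hpi' h
  rcases Sym2.eq_iff.1 h with ⟨h1, h2⟩ | ⟨h1, h2⟩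
  · exact Prod.ext (Sum.inl.inj h1) (edgeTo_injective h2)
  · -- The vertical part of each of the two edges would meet the horizontal part of the other.
    have h3 := (Frame.mem_crossingPairs.1 hpi).2.2.1 i' (edgeTo_eq_inl_iff.1 h1.symm)
    have h4 := (Frame.mem_crossingPairs.1 hpi').2.2.1 i (edgeTo_eq_inl_iff.1 h2)
    exact absurd h3 h4.not_gt

theorem card_output : Nat.card δ.Output = #(Frame.freeOut univ δ.link) := by
  rw [Nat.subtype_card]
  simp [Frame.mem_freeOut]

theorem card_input : Nat.card δ.Input = #(Frame.freeIn univ δ.link) := by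
  rw [Nat.subtype_card]
  simp [Frame.mem_freeIn]

end Wiring

/-! ### The normal form of a product of gates -/

section Word

variable {n : ℕ} (g : Fin n → ℕ × ℕ)

/-- The ports, in the order of the letters of the product of the gates, the newest gate first. -/
def portList : List (OutPort g ⊕ InPort g) :=
  (List.finRange n).reverse.flatMap fun j =>
    (List.finRange (g j).1).map (fun t => .inl ⟨j, t⟩) ++
      (List.finRange (g j).2).reverse.map (fun t => .inr ⟨j, t⟩)

theorem mem_portList (x : OutPort g ⊕ InPort g) : x ∈ portList g := by
  rcases x with ⟨j, t⟩ | ⟨j, t⟩ <;>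
  simp only [portList, List.mem_flatMap, List.mem_reverse, List.mem_finRange, List.mem_append,
    List.mem_map, true_and]
  · exact ⟨j, .inl ⟨t, rfl⟩⟩
  · exact ⟨j, .inr ⟨t, rfl⟩⟩

theorem pairwise_portList : (portList g).Pairwise (portFrame g).Before := by
  rw [portList, List.pairwise_flatMap]
  constructor
  · intro j _
    rw [List.pairwise_append, List.pairwise_map, List.pairwise_map, List.pairwise_reverse]
    refine ⟨(List.pairwise_lt_finRange _).imp fun {s t} h => ?_,
      (List.pairwise_lt_finRange _).imp fun {s t} h => ?_, ?_⟩
    · simpa [Frame.Before, portFrame, column] using h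
    · simpa [Frame.Before, portFrame, row] using h
    · simp only [List.mem_map]
      rintro _ ⟨s, -, rfl⟩ _ ⟨t, -, rfl⟩
      exact lt_irrefl j
  · rw [List.pairwise_reverse]
    refine (List.pairwise_lt_finRange n).imp fun {j k} h => ?_
    simp only [List.mem_append, List.mem_map]
    rintro _ (⟨s, -, rfl⟩ | ⟨s, -, rfl⟩) _ (⟨t, -, rfl⟩ | ⟨t, -, rfl⟩)
    · exact column_lt_column h
    · exact h.not_gt
    · exact h
    · exact row_lt_row h

variable {R A : Type*} [CommRing R] [Ring A] [Algebra R A] {q : R} {X D : A}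

/-- The product of the gates of a family, the newest gate first, is the sum over the diagrams with
these gates of the normally ordered monomials given by their outputs and inputs. -/
theorem sum_wiring_eq_prod (h : D * X = 1 + q • (X * D)) :
    ∑ δ : Wiring g, q ^ δ.crossings • (X ^ Nat.card δ.Output * D ^ Nat.card δ.Input) =
      ((List.finRange n).reverse.map fun j => X ^ (g j).1 * D ^ (g j).2).prod := by
  have hw := Frame.wickSum_eq_prod (F := portFrame g) h (column_injective g) _
    (pairwise_portList g)
  simp only [mem_portList, filter_true] at hw
  have hr : ((portList g).map (Sum.elim (fun _ => X) fun _ => D)).prod =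
      ((List.finRange n).reverse.map fun j => X ^ (g j).1 * D ^ (g j).2).prod := by
    rw [portList, List.map_flatMap, List.flatMap_def, List.prod_flatten]
    simp only [List.map_append, List.prod_append, List.map_map, Function.comp_def,
      Sum.elim_inl, Sum.elim_inr, List.map_const',
      List.prod_replicate, List.length_finRange, List.length_reverse]
  rw [← hr, ← hw, Frame.wickSum]
  refine sum_bij (fun δ _ => δ.link) (fun δ _ => ?_) (fun δ _ δ' _ h => Wiring.ext h)
    (fun f hf => ?_) fun δ _ => ?_
  · exact Frame.mem_contractions.2 ⟨δ.link_inj, fun p i h => ⟨mem_univ _, mem_univ _,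
      δ.link_lt p i h⟩⟩
  · obtain ⟨h1, h2⟩ := Frame.mem_contractions.1 hf
    exact ⟨⟨f, h1, fun p i h => (h2 p i h).2.2⟩, mem_univ _, rfl⟩
  · rw [Frame.wickTerm, δ.crossings_eq_card, δ.card_output, δ.card_input]

/-- The factors are numbered from right to left. -/
theorem sum_smul_pow {ι : Type*} [Fintype ι] (w : ι → R) (m : ι → A) (n : ℕ) :
    (∑ x, w x • m x) ^ n =
      ∑ g : Fin n → ι, (∏ j, w (g j)) • ((List.finRange n).reverse.map fun j => m (g j)).prod := by
  induction n with
  | zero => simp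
  | succ n ih =>
    rw [pow_succ, ih, ← (Fin.consEquiv fun _ => ι).sum_comp, Fintype.sum_prod_type_right,
      sum_mul_sum]
    refine sum_congr rfl fun g _ => sum_congr rfl fun x _ => ?_
    simp only [Fin.consEquiv_apply, Fin.prod_univ_succ, Fin.cons_zero, Fin.cons_succ,
      List.finRange_succ, List.reverse_cons, List.map_append, List.prod_append, List.map_cons,
      List.map_nil, List.prod_singleton, ← List.map_reverse, List.map_map, Function.comp_def]
    rw [smul_mul_smul_comm, mul_comm]

theorem gatePolynomial_pow (h : D * X = 1 + q • (X * D)) (H : Finset (ℕ × ℕ)) (w : H → R) (n : ℕ) :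
    gatePolynomial X D H w ^ n = ∑ δ : Diagram H n,
      (δ.weight w * q ^ δ.2.crossings) • (X ^ δ.numOutputs * D ^ δ.numInputs) := by
  rw [gatePolynomial, sum_smul_pow, Fintype.sum_sigma]
  refine sum_congr rfl fun g _ => ?_
  rw [← sum_wiring_eq_prod _ h, smul_sum]
  exact sum_congr rfl fun δ _ => smul_smul _ _ _

end Word

/-- The family of the values at `q` of the total weights `totalWeight H w n a b`. -/
def coefficients {K R : Type*} [Field K] [CommRing R] [Algebra K R] (q : R) (H : Finset (ℕ × ℕ))
    (w : H → K) (n : ℕ) : ℕ × ℕ →₀ R :=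
  ∑ δ : Diagram H n, Finsupp.single (δ.numOutputs, δ.numInputs)
    (δ.weight (fun x => algebraMap K R (w x)) * q ^ δ.2.crossings)

section Coefficients

variable {K R : Type*} [Field K] [CommRing R] [Algebra K R] (q : R) (H : Finset (ℕ × ℕ))
  (w : H → K) (n : ℕ)

theorem coefficients_apply (a b : ℕ) :
    coefficients q H w n (a, b) = Polynomial.aeval q (totalWeight H w n a b) := by
  rw [coefficients, Finsupp.finsetSum_apply, totalWeight, map_sum, sum_filter]
  refine sum_congr rfl fun δ _ => ?_
  simp only [Finsupp.single_apply, Prod.mk.injEq]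
  split_ifs
  · simp [Diagram.weight]
  · rfl

theorem isNormalForm_coefficients {A : Type*} [Ring A] [Algebra R A] {X D : A}
    (h : D * X = 1 + q • (X * D)) :
    IsNormalForm X D (gatePolynomial X D H (fun x => algebraMap K R (w x)) ^ n)
      (coefficients q H w n) := by
  rw [IsNormalForm, gatePolynomial_pow h, coefficients,
    ← Finsupp.sum_finsetSum_index (by simp) (by simp [add_smul])]
  refine sum_congr rfl fun δ _ => ?_
  rw [Finsupp.sum_single_index (by simp)]

end Coefficients

/-! ### Uniqueness of the normal form in the algebra -/

section QWeyl

variable {R : Type*} [CommRing R] (q : R)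

theorem qNumber_succ' (m : ℕ) : qNumber q (m + 1) = 1 + q * qNumber q m := by
  rw [qNumber, sum_range_succ', qNumber, mul_sum, pow_zero, add_comm]
  simp [pow_succ']

theorem QWeyl.delta_mul_X :
    QWeyl.Delta q * QWeyl.X q = 1 + q • (QWeyl.X q * QWeyl.Delta q) := by
  have := RingQuot.mkAlgHom_rel R (QRel.rel (q := q))
  simpa [QWeyl.Delta, QWeyl.X] using this

/-- The action of `X` on the free module spanned by the normally ordered monomials. -/
def monomialX (R : Type*) [CommRing R] : Module.End R (ℕ × ℕ →₀ R) :=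
  Finsupp.linearCombination R fun ab => Finsupp.single (ab.1 + 1, ab.2) 1

/-- The action of `Δ` on the free module spanned by the normally ordered monomials. When `a = 0`,
the truncated exponent `a - 1` comes with the coefficient `[0] = 0`. -/
def monomialDelta : Module.End R (ℕ × ℕ →₀ R) :=
  Finsupp.linearCombination R fun ab =>
    Finsupp.single (ab.1, ab.2 + 1) (q ^ ab.1) + Finsupp.single (ab.1 - 1, ab.2) (qNumber q ab.1)

theorem monomialX_single (a b : ℕ) (r : R) :
    monomialX R (Finsupp.single (a, b) r) = Finsupp.single (a + 1, b) r := by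
  simp [monomialX]

theorem monomialDelta_single (a b : ℕ) (r : R) :
    monomialDelta q (Finsupp.single (a, b) r) =
      Finsupp.single (a, b + 1) (r * q ^ a) + Finsupp.single (a - 1, b) (r * qNumber q a) := by
  simp [monomialDelta]

theorem monomialDelta_mul_monomialX :
    monomialDelta q * monomialX R = 1 + q • (monomialX R * monomialDelta q) := by
  refine Finsupp.lhom_ext fun ⟨a, b⟩ r => ?_
  have h : Finsupp.single (a - 1 + 1, b) (q * (r * qNumber q a)) =
      Finsupp.single (a, b) (q * (r * qNumber q a)) := by
    cases a with
    | zero => simp [qNumber]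
    | succ a => rfl
  simp only [Module.End.mul_apply, LinearMap.add_apply, LinearMap.smul_apply, Module.End.one_apply,
    monomialX_single, monomialDelta_single, map_add, smul_add, Finsupp.smul_single, smul_eq_mul, h,
    qNumber_succ', mul_add, Finsupp.single_add, Nat.add_sub_cancel, mul_one]
  rw [pow_succ', mul_left_comm r q, mul_left_comm r q]
  abel

/-- The representation of the algebra on the free module spanned by the normally ordered
monomials. -/
def monomialRep : QWeyl q →ₐ[R] Module.End R (ℕ × ℕ →₀ R) :=
  RingQuot.liftAlgHom R ⟨FreeAlgebra.lift R fun
    | .X => monomialX R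
    | .Delta => monomialDelta q, by
      rintro _ _ ⟨⟩
      simpa using monomialDelta_mul_monomialX q⟩

theorem monomialRep_X : monomialRep q (QWeyl.X q) = monomialX R := by
  simp [monomialRep, QWeyl.X]

theorem monomialRep_Delta : monomialRep q (QWeyl.Delta q) = monomialDelta q := by
  simp [monomialRep, QWeyl.Delta]

theorem monomialRep_apply_single (a b : ℕ) :
    monomialRep q (QWeyl.X q ^ a * QWeyl.Delta q ^ b) (Finsupp.single (0, 0) 1) =
      Finsupp.single (a, b) 1 := by
  have hD : (monomialDelta q ^ b) (Finsupp.single (0, 0) 1) = Finsupp.single (0, b) 1 := by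
    induction b with
    | zero => rfl
    | succ b ih => simp [pow_succ', ih, monomialDelta_single, qNumber]
  have hX : (monomialX R ^ a) (Finsupp.single (0, b) 1) = Finsupp.single (a, b) 1 := by
    induction a with
    | zero => rfl
    | succ a ih => simp [pow_succ', ih, monomialX_single]
  rw [map_mul, map_pow, map_pow, monomialRep_X, monomialRep_Delta, Module.End.mul_apply, hD, hX]

/-- A normal form is recovered by letting the element act on the monomial `1`. -/
theorem eq_of_isNormalForm {u : QWeyl q} {c : ℕ × ℕ →₀ R}
    (h : IsNormalForm (QWeyl.X q) (QWeyl.Delta q) u c) :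
    c = monomialRep q u (Finsupp.single (0, 0) 1) := by
  rw [h, map_finsuppSum, Finsupp.sum, LinearMap.sum_apply]
  simp only [map_smul, LinearMap.smul_apply, monomialRep_apply_single, Finsupp.smul_single,
    smul_eq_mul, mul_one]
  exact (Finsupp.sum_single c).symm

end QWeyl

/-! ### Uniqueness of the normal form of an operator -/

section Operators

variable {R : Type*} [CommRing R] (q : R)

theorem coeff_qDiff (f : PowerSeries R) (m : ℕ) :
    PowerSeries.coeff m (qDiff q f) = qNumber q (m + 1) * PowerSeries.coeff (m + 1) f := by
  simp [qDiff]

theorem qDiff_mul_mulX : qDiff q * mulX R = 1 + q • (mulX R * qDiff q) := by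
  refine LinearMap.ext fun f => PowerSeries.ext fun m => ?_
  simp only [Module.End.mul_apply, LinearMap.add_apply, LinearMap.smul_apply, Module.End.one_apply,
    mulX, LinearMap.mulLeft_apply, coeff_qDiff, map_add, PowerSeries.coeff_smul,
    PowerSeries.coeff_succ_X_mul, qNumber_succ' q m, smul_eq_mul]
  cases m with
  | zero => simp [qNumber]
  | succ m =>
    rw [PowerSeries.coeff_succ_X_mul, coeff_qDiff]
    ring

theorem coeff_qDiff_pow (f : PowerSeries R) (b m : ℕ) :
    PowerSeries.coeff m ((qDiff q ^ b) f) =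
      (∏ k ∈ range b, qNumber q (m + k + 1)) * PowerSeries.coeff (m + b) f := by
  induction b generalizing m with
  | zero => simp
  | succ b ih =>
    rw [pow_succ', Module.End.mul_apply, coeff_qDiff, ih, prod_range_succ', ← mul_assoc,
      mul_comm (qNumber q (m + 1))]
    simp only [add_zero, add_assoc, add_comm 1]

theorem mulX_pow_apply (a : ℕ) (f : PowerSeries R) : (mulX R ^ a) f = PowerSeries.X ^ a * f := by
  rw [mulX, LinearMap.pow_mulLeft, LinearMap.mulLeft_apply]

/-- `Δ ^ b` maps `x ^ m` to zero if `m < b` and `x ^ b` to the `q`-factorial of `b`. -/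
theorem qDiff_pow_X_pow {b m : ℕ} (h : m ≤ b) :
    (qDiff q ^ b) (PowerSeries.X ^ m) =
      if m = b then PowerSeries.C (∏ k ∈ range b, qNumber q (k + 1)) else 0 := by
  ext d
  rw [coeff_qDiff_pow, PowerSeries.coeff_X_pow]
  split_ifs with h1 h2 h2
  · obtain rfl : d = 0 := by omega
    simp
  · omega
  · rw [PowerSeries.coeff_C, if_neg (by omega), mul_zero]
  · simp

theorem coeff_monomial_apply {a b m d : ℕ} (h : m ≤ b) :
    PowerSeries.coeff d ((mulX R ^ a * qDiff q ^ b) (PowerSeries.X ^ m)) =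
      if (a, b) = (d, m) then ∏ k ∈ range m, qNumber q (k + 1) else 0 := by
  rw [Module.End.mul_apply, qDiff_pow_X_pow q h, mulX_pow_apply]
  by_cases hmb : m = b
  · subst hmb
    rw [if_pos rfl, PowerSeries.coeff_mul_C, PowerSeries.coeff_X_pow]
    simp [eq_comm]
  · simp [hmb, Ne.symm hmb]

/-- If the coefficients of `X ^ a * Δ ^ b` with `b < m` vanish, then the others with `b = m` are
seen, up to the `q`-factorial of `m`, in the value at `x ^ m`. -/
theorem eq_zero_of_isNormalForm_zero (hq : ∀ m : ℕ, qNumber q (m + 1) ∈ nonZeroDivisors R)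
    {c : ℕ × ℕ →₀ R} (h : IsNormalForm (mulX R) (qDiff q) 0 c) : c = 0 := by
  suffices ∀ m d, c (d, m) = 0 from Finsupp.ext fun ⟨d, m⟩ => this m d
  intro m
  induction m using Nat.strong_induction_on with
  | _ m ih =>
    intro d
    have h0 := congrArg (fun u : Module.End R (PowerSeries R) =>
      PowerSeries.coeff d (u (PowerSeries.X ^ m))) h
    simp only [Finsupp.sum, LinearMap.zero_apply, LinearMap.sum_apply, map_zero, map_sum,
      LinearMap.smul_apply, PowerSeries.coeff_smul] at h0
    have hterm : ∀ x ∈ c.support,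
        c x • PowerSeries.coeff d ((mulX R ^ x.1 * qDiff q ^ x.2) (PowerSeries.X ^ m)) =
          if x = (d, m) then c (d, m) * ∏ k ∈ range m, qNumber q (k + 1) else 0 := by
      rintro ⟨a, b⟩ -
      rcases lt_or_ge b m with hb | hb
      · rw [ih b hb a, zero_smul, if_neg]
        rintro ⟨⟩
        exact lt_irrefl _ hb
      · rw [coeff_monomial_apply q hb]
        split_ifs with hx
        · rw [hx, smul_eq_mul]
        · exact smul_zero _
    rw [sum_congr rfl hterm, sum_ite_eq'] at h0
    by_cases hs : (d, m) ∈ c.support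
    · rw [if_pos hs] at h0
      exact (mul_right_mem_nonZeroDivisors_eq_zero_iff
        (prod_mem fun k _ => hq k)).1 h0.symm
    · exact Finsupp.notMem_support_iff.1 hs

theorem isNormalForm_unique (hq : ∀ m : ℕ, qNumber q (m + 1) ∈ nonZeroDivisors R)
    {u : Module.End R (PowerSeries R)} {c c' : ℕ × ℕ →₀ R}
    (h : IsNormalForm (mulX R) (qDiff q) u c) (h' : IsNormalForm (mulX R) (qDiff q) u c') :
    c = c' := by
  refine sub_eq_zero.1 (eq_zero_of_isNormalForm_zero q hq ?_)
  rw [IsNormalForm, Finsupp.sum_sub_index (by simp [sub_smul]), ← h, ← h', sub_self]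

end Operators

end DeltaDiagram

end

theorem mainTheorem2 {K : Type*} [Field K] {R : Type*} [CommRing R] [Algebra K R] (q : R)
    (H : Finset (ℕ × ℕ)) (w : H → K) (n : ℕ) :
    ∃ c : ℕ × ℕ →₀ R,
      (∀ a b : ℕ, c (a, b) = Polynomial.aeval q (DeltaDiagram.totalWeight H w n a b)) ∧
      (∀ c' : ℕ × ℕ →₀ R,
        DeltaDiagram.IsNormalForm (DeltaDiagram.QWeyl.X q) (DeltaDiagram.QWeyl.Delta q)
          (DeltaDiagram.gatePolynomial (DeltaDiagram.QWeyl.X q) (DeltaDiagram.QWeyl.Delta q) H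
            (fun x => algebraMap K R (w x)) ^ n) c' ↔ c' = c) ∧
      DeltaDiagram.IsNormalForm (DeltaDiagram.mulX R) (DeltaDiagram.qDiff q)
        (DeltaDiagram.gatePolynomial (DeltaDiagram.mulX R) (DeltaDiagram.qDiff q) H
          (fun x => algebraMap K R (w x)) ^ n) c ∧
      ((∀ m : ℕ, DeltaDiagram.qNumber q (m + 1) ∈ nonZeroDivisors R) →
        ∀ c' : ℕ × ℕ →₀ R,
          DeltaDiagram.IsNormalForm (DeltaDiagram.mulX R) (DeltaDiagram.qDiff q)
            (DeltaDiagram.gatePolynomial (DeltaDiagram.mulX R) (DeltaDiagram.qDiff q) H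
              (fun x => algebraMap K R (w x)) ^ n) c' → c' = c) := by
  refine ⟨DeltaDiagram.coefficients q H w n, DeltaDiagram.coefficients_apply q H w n,
    fun c' => ⟨fun h => ?_, ?_⟩, ?_, fun hq c' h => ?_⟩
  · rw [DeltaDiagram.eq_of_isNormalForm q h]
    exact (DeltaDiagram.eq_of_isNormalForm q (DeltaDiagram.isNormalForm_coefficients q H w n
      (DeltaDiagram.QWeyl.delta_mul_X q))).symm
  · rintro rfl
    exact DeltaDiagram.isNormalForm_coefficients q H w n (DeltaDiagram.QWeyl.delta_mul_X q)
  · exact DeltaDiagram.isNormalForm_coefficients q H w n (DeltaDiagram.qDiff_mul_mulX q)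
  · exact DeltaDiagram.isNormalForm_unique q hq h
      (DeltaDiagram.isNormalForm_coefficients q H w n (DeltaDiagram.qDiff_mul_mulX q))
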